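/- Let $n\ge 0$, let $\mathcal H(n)$ be the real vector space of Hermitian $n\times n$ complex matrices and $\mathcal U(n)$ the group of unitary $n\times n$ matrices. Let $\|A\|_1=\operatorname{tr}|A|$, with $|A|=(A^*A)^{1/2}$, be the trace norm and $\|A\|_\infty$ the spectral norm. A piecewise smooth curve $\gamma:[0,1]\to\mathcal H(n)$ has length $L(\gamma)=\int_0^1\|\dot\gamma(t)\|_1\,dt$; a piecewise smooth curve $\gamma:[0,1]\to\mathcal U(n)$ has length $L(\gamma)=\int_0^1\|\gamma(t)^*\dot\gamma(t)\|_1\,dt$, that is, its length for the Finsler metric $\|V\|_{1,U}=\|U^*V\|_1$. In either space a piecewise smooth curve is called minimal if it is not longer than any piecewise smooth curve in that space with the same endpoints. (Smooth means $C^\infty$; piecewise smooth means continuous, and smooth on each closed interval of some finite partition of $[0,1]$.) 1. Let $X:[0,1]\to\mathcal H(n)$ be a smooth curve. Then $\beta(t)=e^{iX(t)}$ is a smooth curve in $\mathcal U(n)$, and $L(\beta)\le L(X)$. 2. Let $Y:[0,1]\to\mathcal H(n)$ be a smooth curve that is minimal in $\mathcal H(n)$, with $Y(0)=0$ and $\|Y(1)\|_\infty\le\pi$.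 Then $\alpha(t)=e^{iY(t)}$ is a minimal curve in $\mathcal U(n)$. -/

import Mathlib

open Set MeasureTheory
open scoped ContDiff Matrix Matrix.Norms.L2Operator MatrixOrder

namespace TraceNormCurves

/-- Complex `n × n` matrices. The norm `‖·‖` in force is the spectral (operator) norm. -/
abbrev Mat (n : ℕ) : Type := Matrix (Fin n) (Fin n) ℂ

/-- The real vector space `H(n)` of Hermitian matrices, as a set of matrices. -/
def hermitians (n : ℕ) : Set (Mat n) := {A | A.IsHermitian}

/-- The unitary group `U(n)`, as a set of matrices. -/
def unitaries (n : ℕ) : Set (Mat n) := {U | U ∈ Matrix.unitaryGroup (Fin n) ℂ}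

/-- The trace norm `‖A‖₁ = tr |A|`, where `|A|` is the positive square root of `Aᴴ A`. -/
noncomputable def traceNorm {n : ℕ} (A : Mat n) : ℝ :=
  (Matrix.trace (CFC.abs A)).re

/-- A smooth curve `[0,1] → M`; values of the function off `[0,1]` are irrelevant. -/
def IsSmoothCurve {n : ℕ} (M : Set (Mat n)) (γ : ℝ → Mat n) : Prop :=
  MapsTo γ (Icc 0 1) M ∧ ContDiffOn ℝ ∞ γ (Icc 0 1)

/-- A piecewise smooth curve `[0,1] → M`: continuous, and smooth on every closed interval of
some finite partition `0 = t₀ < t₁ < ⋯ < tₖ = 1`. -/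
def IsPiecewiseSmoothCurve {n : ℕ} (M : Set (Mat n)) (γ : ℝ → Mat n) : Prop :=
  MapsTo γ (Icc 0 1) M ∧ ContinuousOn γ (Icc 0 1) ∧
    ∃ (k : ℕ) (t : ℕ → ℝ), StrictMono t ∧ t 0 = 0 ∧ t k = 1 ∧
      ∀ i < k, ContDiffOn ℝ ∞ γ (Icc (t i) (t (i + 1)))

/-- The length `∫₀¹ F(γ(t), γ'(t)) dt` of a curve, where `F p` is the Finsler norm on the
tangent space at the point `p`. -/
noncomputable def curveLength {n : ℕ} (F : Mat n → Mat n → ℝ) (γ : ℝ → Mat n) : ℝ :=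
  ∫ t in (0 : ℝ)..1, F (γ t) (derivWithin γ (Icc 0 1) t)

/-- The trace-norm metric on `H(n)`: `‖V‖_{1,A} = ‖V‖₁` at every point `A`. -/
noncomputable def hermitianFinsler {n : ℕ} (_A V : Mat n) : ℝ := traceNorm V

/-- The trace-norm Finsler metric on `U(n)`: `‖V‖_{1,U} = ‖Uᴴ V‖₁` at the point `U`. -/
noncomputable def unitaryFinsler {n : ℕ} (U V : Mat n) : ℝ := traceNorm (Uᴴ * V)

/-- `γ` is a minimal curve in `M` for the Finsler metric `F`: it is a piecewise smooth curve in
`M`, and it is not longer than any piecewise smooth curve in `M` with the same endpoints. -/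
def IsMinimalCurve {n : ℕ} (M : Set (Mat n)) (F : Mat n → Mat n → ℝ) (γ : ℝ → Mat n) : Prop :=
  IsPiecewiseSmoothCurve M γ ∧
    ∀ δ : ℝ → Mat n, IsPiecewiseSmoothCurve M δ → δ 0 = γ 0 → δ 1 = γ 1 →
      curveLength F γ ≤ curveLength F δ

/-- The curve `t ↦ e^{i X(t)}`. -/
noncomputable def expCurve {n : ℕ} (X : ℝ → Mat n) : ℝ → Mat n :=
  fun t => NormedSpace.exp (Complex.I • X t)

end TraceNormCurves
open TraceNormCurves

/-! Everything rests on the duality between trace norm and spectral norm: `|tr(BA)| ≤ ‖B‖ ‖A‖₁`,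
with equality for a suitable contraction `B`.

For the exponential map, `e^{iA} - e^{iB}` is the integral over `[0,1]` of `e^{isA} i(A - B)
e^{i(1-s)B}`, whose outer factors are unitary. Hence `A ↦ e^{iA}` is 1-Lipschitz for the trace norm
(`norm_trace_mul_exp_sub_exp_le`), and passing to difference quotients compares the speeds of
`e^{iX}` and `X`.

For minimality, comparing `Y` with the straight segment gives `L(e^{iY}) ≤ L(Y) ≤ ‖Y(1)‖₁`, so it
remains to bound below the length of any unitary curve from `1` to `e^{iH}`, `‖H‖ ≤ π`, by `‖H‖₁`
(`traceNorm_le_curveLength`). The calibrating function is `U ↦ tr arccos((U + U*)/2)`, the sum of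
the absolute arguments of the eigenvalues: it is `0` at `1` and `‖H‖₁` at `e^{iH}`, and should grow
no faster than arc length. As `arccos` is singular at `±1`, it is replaced by a polynomial `p` with
`|p'(x)| √(1 - x²) ≤ 1 + ε` (`exists_polynomial_near_arccos`), and `ε` tends to `0`. -/

namespace TraceNormCurves

variable {n : ℕ}

/-! ### The trace norm -/

lemma continuous_traceNorm : Continuous (traceNorm : Mat n → ℝ) :=
  Complex.continuous_re.comp (Continuous.matrix_trace CFC.continuous_abs)

open ComplexOrder in
lemma traceNorm_nonneg (A : Mat n) : 0 ≤ traceNorm A :=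
  (Complex.le_def.1 (Matrix.nonneg_iff_posSemidef.1 (CFC.abs_nonneg A)).trace_nonneg).1

lemma traceNorm_smul (c : ℂ) (A : Mat n) : traceNorm (c • A) = ‖c‖ * traceNorm A := by
  simp [traceNorm, CFC.abs_smul]

lemma traceNorm_real_smul (c : ℝ) (A : Mat n) : traceNorm (c • A) = |c| * traceNorm A := by
  rw [← Complex.coe_smul, traceNorm_smul]
  simp

lemma trace_cfc {A : Mat n} (hA : A.IsHermitian) (f : ℝ → ℝ) :
    (cfc f A).trace = ∑ j, (f (hA.eigenvalues j) : ℂ) := by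
  rw [hA.cfc_eq, Matrix.IsHermitian.cfc, Unitary.conjStarAlgAut_apply, Matrix.trace_mul_cycle,
    Unitary.coe_star_mul_self, one_mul, Matrix.trace_diagonal]
  rfl

lemma traceNorm_eq_sum_eigenvalues {A : Mat n} (hA : A.IsHermitian) :
    traceNorm A = ∑ j, |hA.eigenvalues j| := by
  rw [traceNorm, CFC.abs_eq_cfc_norm A hA, trace_cfc hA]
  simp

lemma norm_apply_le_norm (A : Mat n) (i j : Fin n) : ‖A i j‖ ≤ ‖A‖ := by
  have h := Matrix.l2_opNorm_mulVec A (EuclideanSpace.single j 1)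
  simp only [PiLp.norm_single, norm_one, mul_one] at h
  refine le_trans ?_ h
  refine le_trans (le_of_eq ?_) (PiLp.norm_apply_le _ i)
  simp [Matrix.mulVec_single]

/-- Equality fails for `n = 0`, where the identity is the zero matrix. -/
lemma norm_one_le : ‖(1 : Mat n)‖ ≤ 1 := by
  rw [← Matrix.diagonal_one, Matrix.l2_opNorm_diagonal]
  exact (pi_norm_le_iff_of_nonneg zero_le_one).2 fun _ => by simp

lemma norm_unitary_le {U : Mat n} (hU : U ∈ Matrix.unitaryGroup (Fin n) ℂ) : ‖U‖ ≤ 1 := by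
  have h := Matrix.l2_opNorm_conjTranspose_mul_self U
  rw [← Matrix.star_eq_conjTranspose, Matrix.mem_unitaryGroup_iff'.1 hU] at h
  nlinarith [norm_one_le (n := n), norm_nonneg U]

lemma abs_eigenvalues_le_norm {A : Mat n} (hA : A.IsHermitian) (j : Fin n) :
    |hA.eigenvalues j| ≤ ‖A‖ := by
  have h := spectrum.norm_le_norm_mul_of_mem (hA.eigenvalues_mem_spectrum_real j)
  exact h.trans (mul_le_of_le_one_right (norm_nonneg A) norm_one_le)

/-- Hölder's inequality between the spectral norm and the trace norm. -/
lemma norm_trace_mul_le_of_isHermitian (B : Mat n) {A : Mat n} (hA : A.IsHermitian) :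
    ‖(B * A).trace‖ ≤ ‖B‖ * traceNorm A := by
  set U : Mat n := (hA.eigenvectorUnitary : Mat n) with hU
  have hUn : ‖U‖ ≤ 1 := norm_unitary_le hA.eigenvectorUnitary.2
  have hUs : ‖star U‖ ≤ 1 := by rwa [norm_star]
  -- In an eigenbasis of `A` the trace is a combination of diagonal entries of `U* B U`, each of
  -- modulus at most `‖B‖`.
  have key : (B * A).trace = ∑ j, (star U * B * U) j j * (hA.eigenvalues j : ℂ) := by
    conv_lhs => rw [hA.spectral_theorem, Unitary.conjStarAlgAut_apply, ← hU, ← mul_assoc,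
      Matrix.trace_mul_comm, ← mul_assoc, ← mul_assoc]
    simp [Matrix.trace, Matrix.mul_diagonal]
  rw [key, traceNorm_eq_sum_eigenvalues hA, Finset.mul_sum]
  refine (norm_sum_le _ _).trans (Finset.sum_le_sum fun j _ => ?_)
  rw [norm_mul, Complex.norm_real, Real.norm_eq_abs]
  refine mul_le_mul_of_nonneg_right ((norm_apply_le_norm _ j j).trans ?_) (abs_nonneg _)
  calc ‖star U * B * U‖ ≤ ‖star U‖ * ‖B‖ * ‖U‖ :=
        (norm_mul_le _ _).trans (mul_le_mul_of_nonneg_right (norm_mul_le _ _) (norm_nonneg _))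
    _ ≤ 1 * ‖B‖ * 1 := by gcongr
    _ = ‖B‖ := by ring

/-- The equality case of Hölder's inequality: `S = sign(A)` works because `sign(A) A = |A|`. -/
lemma exists_norm_le_one_trace_mul_eq {A : Mat n} (hA : A.IsHermitian) :
    ∃ S : Mat n, ‖S‖ ≤ 1 ∧ (S * A).trace = traceNorm A := by
  have hA' : IsSelfAdjoint A := hA
  have hc (f : ℝ → ℝ) : ContinuousOn f (spectrum ℝ A) :=
    (Matrix.finite_real_spectrum (A := A)).continuousOn f
  refine ⟨cfc (fun x : ℝ => (SignType.sign x : ℝ)) A, norm_cfc_le zero_le_one fun x _ => ?_, ?_⟩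
  · rcases lt_trichotomy x 0 with h | h | h <;> simp [h]
  · have h : cfc (fun x : ℝ => (SignType.sign x : ℝ)) A * A
        = cfc (fun x : ℝ => (SignType.sign x : ℝ) * x) A := by
      rw [cfc_mul _ _ A (hc _) (hc _), cfc_id' ℝ A hA']
    rw [h, trace_cfc hA]
    rw [traceNorm_eq_sum_eigenvalues hA]
    push_cast
    simp [← Complex.ofReal_mul, sign_mul_self]

lemma isHermitian_I_smul {A : Mat n} (hA : Aᴴ = -A) : (Complex.I • A).IsHermitian := by
  rw [Matrix.IsHermitian, Matrix.conjTranspose_smul, hA]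
  simp

lemma traceNorm_I_smul (A : Mat n) : traceNorm (Complex.I • A) = traceNorm A := by
  simp [traceNorm_smul]

lemma norm_trace_mul_le_of_skew (B : Mat n) {A : Mat n} (hA : Aᴴ = -A) :
    ‖(B * A).trace‖ ≤ ‖B‖ * traceNorm A := by
  have h := norm_trace_mul_le_of_isHermitian B (isHermitian_I_smul hA)
  rwa [traceNorm_I_smul, Matrix.mul_smul, Matrix.trace_smul, norm_smul, Complex.norm_I,
    one_mul] at h

lemma exists_norm_le_one_trace_mul_eq_of_skew {A : Mat n} (hA : Aᴴ = -A) :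
    ∃ S : Mat n, ‖S‖ ≤ 1 ∧ (S * A).trace = traceNorm A := by
  obtain ⟨S, hS, h⟩ := exists_norm_le_one_trace_mul_eq (isHermitian_I_smul hA)
  refine ⟨Complex.I • S, by simpa [norm_smul] using hS, ?_⟩
  rwa [traceNorm_I_smul, Matrix.mul_smul, ← Matrix.smul_mul] at h

/-! ### Curves in the unitary group and the exponential map -/

lemma exp_I_smul_mem_unitaryGroup {A : Mat n} (hA : A.IsHermitian) :
    NormedSpace.exp (Complex.I • A) ∈ Matrix.unitaryGroup (Fin n) ℂ :=
  (selfAdjoint.expUnitary ⟨A, hA⟩).2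

lemma contDiff_exp : ContDiff ℝ ∞ (NormedSpace.exp : Mat n → Mat n) :=
  contDiff_iff_contDiffAt.2 fun x => (NormedSpace.exp_analytic x).contDiffAt

lemma hasDerivAt_exp_smul (A : Mat n) (t : ℝ) :
    HasDerivAt (fun s : ℝ => NormedSpace.exp (s • A)) (NormedSpace.exp (t • A) * A) t :=
  hasDerivAt_exp_smul_const A t

lemma hasDerivAt_exp_smul' (A : Mat n) (t : ℝ) :
    HasDerivAt (fun s : ℝ => NormedSpace.exp (s • A)) (A * NormedSpace.exp (t • A)) t :=
  hasDerivAt_exp_smul_const' A t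

lemma isHermitian_real_smul {A : Mat n} (hA : A.IsHermitian) (s : ℝ) : (s • A).IsHermitian := by
  rw [Matrix.IsHermitian, Matrix.conjTranspose_smul, hA.eq, star_trivial]

/-- Trace of a product as a continuous linear functional of the second factor. -/
noncomputable def traceMulCLM (V : Mat n) : Mat n →L[ℝ] ℂ :=
  LinearMap.toContinuousLinearMap
    { toFun := fun A => (V * A).trace
      map_add' := fun A B => by rw [mul_add, Matrix.trace_add]
      map_smul' := fun c A => by rw [Matrix.mul_smul, Matrix.trace_smul, RingHom.id_apply] }

@[simp] lemma traceMulCLM_apply (V A : Mat n) : traceMulCLM V A = (V * A).trace := rfl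

/-- The exponential map does not increase distances, tested against a contraction. -/
lemma norm_trace_mul_exp_sub_exp_le {A B V : Mat n} (hA : A.IsHermitian) (hB : B.IsHermitian)
    (hV : ‖V‖ ≤ 1) :
    ‖(V * (NormedSpace.exp (Complex.I • A) - NormedSpace.exp (Complex.I • B))).trace‖
      ≤ traceNorm (A - B) := by
  set E : ℝ → Mat n := fun s => NormedSpace.exp (s • (Complex.I • A))
  set F : ℝ → Mat n := fun s => NormedSpace.exp ((1 - s) • (Complex.I • B))
  have hE (s : ℝ) : ‖E s‖ ≤ 1 := by
    have := exp_I_smul_mem_unitaryGroup (isHermitian_real_smul hA s)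
    rw [smul_comm] at this
    exact norm_unitary_le this
  have hF (s : ℝ) : ‖F s‖ ≤ 1 := by
    have := exp_I_smul_mem_unitaryGroup (isHermitian_real_smul hB (1 - s))
    rw [smul_comm] at this
    exact norm_unitary_le this
  -- The path `E s * F s` runs from `e^{iB}` to `e^{iA}`; the two terms of the product rule merge
  -- because `A` commutes with `E s` and `B` with `F s`.
  have hd (s : ℝ) : HasDerivAt (fun s => traceMulCLM V (E s * F s))
      (traceMulCLM V (E s * (Complex.I • (A - B)) * F s)) s := by
    have h1 := hasDerivAt_exp_smul (Complex.I • A) s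
    have h2 := (hasDerivAt_exp_smul' (Complex.I • B) (1 - s)).scomp s
      ((hasDerivAt_id s).const_sub 1)
    have h3 := h1.mul h2
    refine (((traceMulCLM V).hasFDerivAt.comp_hasDerivAt s h3)).congr_deriv ?_
    congr 1
    simp only [E, F, smul_sub, mul_sub, sub_mul, neg_smul, one_smul, mul_neg, ← mul_assoc,
      Function.comp_apply]
    rfl
  have hb (s : ℝ) : ‖traceMulCLM V (E s * (Complex.I • (A - B)) * F s)‖ ≤ traceNorm (A - B) := by
    have h := norm_trace_mul_le_of_isHermitian (F s * V * E s) (hA.sub hB)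
    have h0 := traceNorm_nonneg (A - B)
    have h1 : ‖F s * V * E s‖ ≤ 1 := by
      calc ‖F s * V * E s‖ ≤ ‖F s‖ * ‖V‖ * ‖E s‖ :=
            (norm_mul_le _ _).trans (mul_le_mul_of_nonneg_right (norm_mul_le _ _) (norm_nonneg _))
        _ ≤ 1 * 1 * 1 := by gcongr <;> first | exact hE s | exact hF s
        _ = 1 := by ring
    have h2 : traceMulCLM V (E s * (Complex.I • (A - B)) * F s)
        = Complex.I * (F s * V * E s * (A - B)).trace := by
      rw [traceMulCLM_apply, Matrix.mul_smul, Matrix.smul_mul, Matrix.mul_smul, Matrix.trace_smul,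
        smul_eq_mul, ← mul_assoc, Matrix.trace_mul_comm]
      simp only [mul_assoc]
    rw [h2, norm_mul, Complex.norm_I, one_mul]
    exact h.trans (mul_le_of_le_one_left h0 h1)
  have key := norm_image_sub_le_of_norm_deriv_le_segment_01'
    (fun s _ => (hd s).hasDerivWithinAt) (fun s _ => hb s)
  simpa [E, F, mul_sub] using key

/-- Differentiate `γ* γ = 1`. -/
lemma conjTranspose_mul_deriv_skew {γ : ℝ → Mat n} {γ' : Mat n} {s : Set ℝ} {t : ℝ}
    (hs : UniqueDiffWithinAt ℝ s t) (ht : t ∈ s) (hγ : MapsTo γ s (unitaries n))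
    (h : HasDerivWithinAt γ γ' s t) : ((γ t)ᴴ * γ')ᴴ = -((γ t)ᴴ * γ') := by
  have h1 := h.star.mul h
  have h2 : HasDerivWithinAt (fun _ => (1 : Mat n)) (star γ' * γ t + star (γ t) * γ') s t :=
    h1.congr (fun x hx => (Matrix.mem_unitaryGroup_iff'.1 (hγ hx)).symm)
      (Matrix.mem_unitaryGroup_iff'.1 (hγ ht)).symm
  have h3 := hs.eq_deriv _ h2 (hasDerivWithinAt_const t s 1)
  rw [Matrix.conjTranspose_mul, Matrix.conjTranspose_conjTranspose]
  exact eq_neg_of_add_eq_zero_left h3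

/-- A contraction `S` norming `U* β'` turns the speed into a linear functional of `β'`. The
Lipschitz bound then passes to the limit of difference quotients, with no formula for the
differential of `exp`. -/
lemma unitaryFinsler_deriv_expCurve_le {X : ℝ → Mat n} {X' β' : Mat n} {s : Set ℝ} {t : ℝ}
    (hs : UniqueDiffWithinAt ℝ s t) (ht : t ∈ s) (hX : MapsTo X s (hermitians n))
    (h : HasDerivWithinAt X X' s t) (hβ : HasDerivWithinAt (expCurve X) β' s t) :
    unitaryFinsler (expCurve X t) β' ≤ traceNorm X' := by
  have hu : MapsTo (expCurve X) s (unitaries n) := fun x hx =>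
    exp_I_smul_mem_unitaryGroup (hX hx)
  obtain ⟨S, hS, hSt⟩ :=
    exists_norm_le_one_trace_mul_eq_of_skew (conjTranspose_mul_deriv_skew hs ht hu hβ)
  set V := S * (expCurve X t)ᴴ
  have hV : ‖V‖ ≤ 1 := by
    refine (norm_mul_le _ _).trans (mul_le_one₀ hS (norm_nonneg _) ?_)
    rw [Matrix.l2_opNorm_conjTranspose]
    exact norm_unitary_le (hu ht)
  have hne : (nhdsWithin t (s \ {t})).NeBot :=
    (accPt_principal_iff_nhdsWithin).1 hs.accPt
  have h1 := (((traceMulCLM V).continuous.norm.tendsto _).comp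
    (hasDerivWithinAt_iff_tendsto_slope.1 hβ))
  have h2 := ((continuous_traceNorm.tendsto _).comp (hasDerivWithinAt_iff_tendsto_slope.1 h))
  have h3 := le_of_tendsto_of_tendsto h1 h2 (by
    filter_upwards [self_mem_nhdsWithin] with x hx
    have h4 := norm_trace_mul_exp_sub_exp_le (hX hx.1) (hX ht) hV
    simp only [Function.comp_apply, slope_def_module, map_smul, norm_smul, traceNorm_real_smul,
      Real.norm_eq_abs]
    exact mul_le_mul_of_nonneg_left h4 (abs_nonneg _))
  refine le_trans (le_of_eq ?_) h3
  rw [traceMulCLM_apply, mul_assoc, hSt, Complex.norm_real, Real.norm_eq_abs,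
    abs_of_nonneg (traceNorm_nonneg _), unitaryFinsler]

lemma isSmoothCurve_expCurve {X : ℝ → Mat n} (hX : IsSmoothCurve (hermitians n) X) :
    IsSmoothCurve (unitaries n) (expCurve X) :=
  ⟨fun _ ht => exp_I_smul_mem_unitaryGroup (hX.1 ht),
    contDiff_exp.comp_contDiffOn (hX.2.const_smul Complex.I)⟩

lemma continuousOn_unitaryFinsler_derivWithin {γ : ℝ → Mat n} {a b : ℝ} (hab : a < b)
    (h : ContDiffOn ℝ ∞ γ (Icc a b)) :
    ContinuousOn (fun t => unitaryFinsler (γ t) (derivWithin γ (Icc a b) t)) (Icc a b) :=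
  continuous_traceNorm.comp_continuousOn
    (h.continuousOn.star.mul (h.continuousOn_derivWithin (uniqueDiffOn_Icc hab) (by simp)))

lemma curveLength_expCurve_le {X : ℝ → Mat n} (hX : IsSmoothCurve (hermitians n) X) :
    curveLength unitaryFinsler (expCurve X) ≤ curveLength hermitianFinsler X := by
  have hu := isSmoothCurve_expCurve hX
  have huniq := uniqueDiffOn_Icc (zero_lt_one' ℝ)
  refine intervalIntegral.integral_mono_on zero_le_one
    (ContinuousOn.intervalIntegrable_of_Icc zero_le_one
      (continuousOn_unitaryFinsler_derivWithin zero_lt_one hu.2))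
    (ContinuousOn.intervalIntegrable_of_Icc zero_le_one
      (continuous_traceNorm.comp_continuousOn (hX.2.continuousOn_derivWithin huniq (by simp))))
    fun t ht => ?_
  exact unitaryFinsler_deriv_expCurve_le (huniq t ht) ht hX.1
    ((hX.2.differentiableOn (by simp)) t ht).hasDerivWithinAt
    ((hu.2.differentiableOn (by simp)) t ht).hasDerivWithinAt

/-! ### Polynomial approximation of the arc cosine -/

lemma exists_derivative_eq (q : Polynomial ℝ) : ∃ p : Polynomial ℝ, p.derivative = q := by
  induction q using Polynomial.induction_on' with
  | add p q hp hq =>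
    obtain ⟨a, rfl⟩ := hp
    obtain ⟨b, rfl⟩ := hq
    exact ⟨a + b, Polynomial.derivative_add⟩
  | monomial k c =>
    refine ⟨Polynomial.monomial (k + 1) (c / (k + 1)), ?_⟩
    rw [Polynomial.derivative_monomial]
    congr 1
    push_cast
    field_simp

lemma hasDerivAt_arccos_mul {r : ℝ} (hr0 : 0 ≤ r) (hr : r < 1) {x : ℝ} (hx : x ∈ Icc (-1 : ℝ) 1) :
    HasDerivAt (fun x => Real.arccos (r * x)) (-(r / √(1 - (r * x) ^ 2))) x := by
  have h1 : r * x < 1 := by nlinarith [hx.1, hx.2]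
  have h2 : -1 < r * x := by nlinarith [hx.1, hx.2]
  refine ((Real.hasDerivAt_arccos h2.ne' h1.ne).comp x
    ((hasDerivAt_id x).const_mul r)).congr_deriv ?_
  ring

/-- `p'` is a Weierstrass approximation of the derivative of `arccos (r * x)`, with `r < 1` close to
`1` so that this derivative is continuous on `[-1,1]`. The weighted bound survives since `r √(1 -
x²) ≤ √(1 - (r x)²)`. -/
lemma exists_polynomial_near_arccos {ε : ℝ} (hε : 0 < ε) :
    ∃ p : Polynomial ℝ,
      (∀ x ∈ Icc (-1 : ℝ) 1, (p.derivative.eval x) ^ 2 * (1 - x ^ 2) ≤ (1 + ε) ^ 2) ∧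
      ∀ x ∈ Icc (-1 : ℝ) 1, Real.arccos x - ε ≤ p.eval x - p.eval 1 := by
  obtain ⟨η, hη, hη'⟩ := Metric.uniformContinuousOn_iff.1
    (isCompact_Icc.uniformContinuousOn_of_continuous
      (Real.continuous_arccos.continuousOn (s := Icc (-1 : ℝ) 1))) (ε / 4) (by positivity)
  set m := min (η / 2) (1 / 2) with hm
  have hm0 : 0 < m := by positivity
  have hm1 : m ≤ 1 / 2 := min_le_right _ _
  have hm2 : m < η := (min_le_left _ _).trans_lt (by linarith)
  set r := 1 - m with hrdef
  have hr0 : 0 ≤ r := by linarith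
  have hr1 : r < 1 := by linarith
  have hpos {x : ℝ} (hx : x ∈ Icc (-1 : ℝ) 1) : 0 < 1 - (r * x) ^ 2 := by
    have h1 : |r * x| < 1 := by
      rw [abs_mul, abs_of_nonneg hr0]
      have : |x| ≤ 1 := abs_le.2 hx
      nlinarith
    nlinarith [sq_abs (r * x), abs_nonneg (r * x)]
  have hclose {x : ℝ} (hx : x ∈ Icc (-1 : ℝ) 1) :
      |Real.arccos (r * x) - Real.arccos x| < ε / 4 := by
    have hrx : r * x ∈ Icc (-1 : ℝ) 1 := by
      constructor <;> nlinarith [hx.1, hx.2]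
    refine hη' _ hrx _ hx ?_
    have h1 : r * x - x = -(m * x) := by rw [hrdef]; ring
    rw [Real.dist_eq, h1, abs_neg, abs_mul, abs_of_pos hm0]
    have : |x| ≤ 1 := abs_le.2 hx
    nlinarith
  obtain ⟨q, hq⟩ := exists_polynomial_near_of_continuousOn (-1) 1
    (fun x => -(r / √(1 - (r * x) ^ 2)))
    (ContinuousOn.neg (ContinuousOn.div (by fun_prop) (by fun_prop)
      fun x hx => (Real.sqrt_pos.2 (hpos hx)).ne')) (ε / 4) (by positivity)
  obtain ⟨p, rfl⟩ := exists_derivative_eq q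
  refine ⟨p, fun x hx => ?_, fun x hx => ?_⟩
  · have h1 : 0 ≤ 1 - x ^ 2 := by nlinarith [hx.1, hx.2]
    have h2 := Real.sqrt_pos.2 (hpos hx)
    have h3 : √(1 - x ^ 2) ≤ 1 := Real.sqrt_le_one.2 (by nlinarith [sq_nonneg x])
    have h4 : r * √(1 - x ^ 2) ≤ √(1 - (r * x) ^ 2) := by
      refine Real.le_sqrt_of_sq_le ?_
      rw [mul_pow, Real.sq_sqrt h1]
      nlinarith
    have h5 : |p.derivative.eval x| ≤ r / √(1 - (r * x) ^ 2) + ε / 4 := by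
      have h6 := abs_lt.1 (hq x hx)
      have h7 : 0 ≤ r / √(1 - (r * x) ^ 2) := by positivity
      exact abs_le.2 ⟨by linarith [h6.1], by linarith [h6.2]⟩
    have h6 : |p.derivative.eval x| * √(1 - x ^ 2) ≤ 1 + ε := by
      calc _ ≤ (r / √(1 - (r * x) ^ 2) + ε / 4) * √(1 - x ^ 2) := by gcongr
        _ = r * √(1 - x ^ 2) / √(1 - (r * x) ^ 2) + ε / 4 * √(1 - x ^ 2) := by ring
        _ ≤ 1 + ε / 4 * 1 := by
          gcongr
          exact (div_le_one h2).2 h4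
        _ ≤ 1 + ε := by linarith
    have h7 := pow_le_pow_left₀ (by positivity) h6 2
    rwa [mul_pow, sq_abs, Real.sq_sqrt h1] at h7
  · have h1 : (1 : ℝ) ∈ Icc (-1 : ℝ) 1 := by simp
    have hd (y : ℝ) (hy : y ∈ Icc (-1 : ℝ) 1) :
        HasDerivWithinAt (fun y => p.eval y - Real.arccos (r * y))
          (p.derivative.eval y - -(r / √(1 - (r * y) ^ 2))) (Icc (-1) 1) y :=
      ((p.hasDerivAt y).sub (hasDerivAt_arccos_mul hr0 hr1 hy)).hasDerivWithinAt
    -- The error `ε` splits as `ε/4` at each of `x` and `1` for replacing `x` by `r * x`, and `2 ·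
    -- ε/4` from integrating the error in `p'` over a length of at most `2`.
    have h2 := (convex_Icc (-1 : ℝ) 1).norm_image_sub_le_of_norm_hasDerivWithin_le hd
      (fun y hy => (hq y hy).le) h1 hx
    simp only [Real.norm_eq_abs] at h2
    have h3 : |x - 1| ≤ 2 := abs_le.2 ⟨by linarith [hx.1], by linarith [hx.2]⟩
    have h4 := (abs_le.1 h2).1
    have h5 := abs_lt.1 (hclose hx)
    have h6 := abs_lt.1 (hclose h1)
    rw [Real.arccos_one] at h6
    nlinarith [h5.1, h6.2]

/-! ### Spectral trace functions along curves of unitaries -/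

open Polynomial

/-- The Hermitian part `(U + Uᴴ) / 2`; for a unitary `U = e^{iH}` this is `cos H`. -/
noncomputable def cosPart (U : Mat n) : Mat n := (1 / 2 : ℝ) • (U + star U)

/-- The skew-Hermitian part `(U - Uᴴ) / 2`; for a unitary `U = e^{iH}` this is `i sin H`. -/
noncomputable def sinPart (U : Mat n) : Mat n := (1 / 2 : ℝ) • (U - star U)

lemma isSelfAdjoint_cosPart (U : Mat n) : IsSelfAdjoint (cosPart U) := by
  simp [IsSelfAdjoint, cosPart, add_comm]

lemma star_sinPart (U : Mat n) : star (sinPart U) = -sinPart U := by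
  simp [sinPart, ← smul_neg]

/-- `C'` need not commute with `C`, but cyclicity of the trace makes all terms in the derivative of
`C ^ k` equal. -/
lemma hasDerivWithinAt_trace_aeval {C : ℝ → Mat n} {C' : Mat n} {s : Set ℝ} {t : ℝ}
    (h : HasDerivWithinAt C C' s t) (p : ℝ[X]) :
    HasDerivWithinAt (fun x => (aeval (C x) p).trace)
      ((aeval (C t) (derivative p) * C').trace) s t := by
  induction p using Polynomial.induction_on' with
  | add p q hp hq =>
    simp only [map_add, Matrix.trace_add, add_mul]
    exact hp.add hq
  | monomial k c =>
    have h1 := ((traceMulCLM (1 : Mat n)).hasFDerivAt.comp_hasDerivWithinAt t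
      (h.fun_pow' k)).const_smul c
    refine (h1.congr (fun x _ => ?_) ?_).congr_deriv ?_
    · simp [aeval_monomial, Algebra.algebraMap_eq_smul_one]
    · simp [aeval_monomial, Algebra.algebraMap_eq_smul_one]
    · have h2 : ∀ i ∈ Finset.range k, (C t ^ (k.pred - i) * C' * C t ^ i).trace
          = (C t ^ (k - 1) * C').trace := fun i hi => by
        rw [Matrix.trace_mul_comm, ← mul_assoc, ← pow_add]
        have := Finset.mem_range.1 hi
        congr 3
        simp only [Nat.pred_eq_sub_one]
        omega
      rw [traceMulCLM_apply, one_mul, Matrix.trace_sum, Finset.sum_congr rfl h2]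
      simp [derivative_monomial, aeval_monomial, Algebra.algebraMap_eq_smul_one, mul_smul]

lemma commute_star_of_mem_unitaryGroup {U : Mat n} (hU : U ∈ Matrix.unitaryGroup (Fin n) ℂ) :
    Commute U (star U) :=
  (Matrix.mem_unitaryGroup_iff.1 hU).trans (Matrix.mem_unitaryGroup_iff'.1 hU).symm

lemma commute_cosPart_star {U : Mat n} (hU : U ∈ Matrix.unitaryGroup (Fin n) ℂ) :
    Commute (cosPart U) (star U) :=
  ((commute_star_of_mem_unitaryGroup hU).add_left (Commute.refl _)).smul_left _

lemma commute_cosPart_sinPart {U : Mat n} (hU : U ∈ Matrix.unitaryGroup (Fin n) ℂ) :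
    Commute (cosPart U) (sinPart U) :=
  (((((Commute.refl U).add_left (commute_star_of_mem_unitaryGroup hU).symm).smul_left _).sub_right
    (commute_cosPart_star hU))).smul_right _

lemma commute_aeval {A B : Mat n} (h : Commute A B) (p : ℝ[X]) : Commute (aeval A p) B := by
  induction p using Polynomial.induction_on' with
  | add p q hp hq => simpa using hp.add_left hq
  | monomial k c =>
    rw [aeval_monomial]
    exact Commute.mul_left (Algebra.commutes c B) (h.pow_left k)

lemma norm_cosPart_le {U : Mat n} (hU : U ∈ Matrix.unitaryGroup (Fin n) ℂ) : ‖cosPart U‖ ≤ 1 := by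
  have h := norm_unitary_le hU
  have h1 := norm_add_le U (star U)
  rw [norm_star] at h1
  rw [cosPart, norm_smul, Real.norm_of_nonneg (by norm_num)]
  linarith

lemma star_sinPart_mul_sinPart {U : Mat n} (hU : U ∈ Matrix.unitaryGroup (Fin n) ℂ) :
    star (sinPart U) * sinPart U = 1 - cosPart U ^ 2 := by
  have h1 := Matrix.mem_unitaryGroup_iff.1 hU
  have h2 := Matrix.mem_unitaryGroup_iff'.1 hU
  rw [star_sinPart, sinPart, cosPart, sq]
  simp only [smul_mul_smul_comm, neg_mul, mul_add, add_mul, mul_sub, sub_mul, h1, h2]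
  module

lemma isSelfAdjoint_aeval {A : Mat n} (hA : IsSelfAdjoint A) (q : ℝ[X]) :
    IsSelfAdjoint (aeval A q) := by
  rw [← cfc_polynomial q A hA]
  exact cfc_predicate _ A

/-- Since `S* S = 1 - C²` for the two parts `C`, `S` of `U`, the squared norm is that of `q² (1 -
X²)` evaluated at `C`, whose spectrum lies in `[-1,1]`. -/
lemma norm_aeval_mul_sinPart_le {U : Mat n} (hU : U ∈ Matrix.unitaryGroup (Fin n) ℂ) {q : ℝ[X]}
    {c : ℝ} (hc : 0 ≤ c) (hq : ∀ x ∈ Icc (-1 : ℝ) 1, q.eval x ^ 2 * (1 - x ^ 2) ≤ c ^ 2) :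
    ‖aeval (cosPart U) q * sinPart U‖ ≤ c := by
  have hsa := isSelfAdjoint_cosPart U
  have h1 : star (aeval (cosPart U) q * sinPart U) * (aeval (cosPart U) q * sinPart U)
      = aeval (cosPart U) (q ^ 2 * (1 - X ^ 2)) := by
    rw [(commute_aeval (commute_cosPart_sinPart hU) q).eq, star_mul,
      (isSelfAdjoint_aeval hsa q).star_eq, mul_assoc, ← mul_assoc (star (sinPart U)),
      star_sinPart_mul_sinPart hU]
    have h2 : (1 : Mat n) - cosPart U ^ 2 = aeval (cosPart U) (1 - X ^ 2 : ℝ[X]) := by simp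
    rw [h2, ← map_mul, ← map_mul]
    congr 1
    ring
  have h2 : ‖aeval (cosPart U) (q ^ 2 * (1 - X ^ 2))‖ ≤ c ^ 2 := by
    rw [← cfc_polynomial _ _ hsa]
    refine norm_cfc_le (by positivity) fun x hx => ?_
    have h3 := (spectrum.norm_le_norm_mul_of_mem hx).trans
      (mul_le_one₀ (norm_cosPart_le hU) (norm_nonneg _) norm_one_le)
    rw [Real.norm_eq_abs] at h3
    have h4 : 0 ≤ 1 - x ^ 2 := by nlinarith [sq_abs x, abs_nonneg x]
    rw [Real.norm_of_nonneg (by simp only [eval_mul, eval_pow, eval_sub, eval_one, eval_X]; positivity)]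
    simpa using hq x (abs_le.1 h3)
  rw [← h1, CStarRing.norm_star_mul_self, ← sq] at h2
  exact le_of_sq_le_sq h2 hc

/-- For skew `A`, `(U A)* = -A U*`, and under the trace against `P` the factor `U*` can be moved to
the left of `A`. -/
lemma trace_mul_cosPart_deriv {U A P : Mat n} (hA : star A = -A) (hP : Commute P (star U)) :
    (P * cosPart (U * A)).trace = (P * sinPart U * A).trace := by
  have h1 : (P * (A * star U)).trace = (P * (star U * A)).trace := by
    rw [← mul_assoc, Matrix.trace_mul_comm, ← mul_assoc, ← mul_assoc, hP.eq]
  rw [cosPart, sinPart, star_mul, hA]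
  simp only [Matrix.mul_smul, Matrix.smul_mul, Matrix.trace_smul, neg_mul, mul_add, mul_neg,
    mul_sub, sub_mul, Matrix.trace_add, Matrix.trace_neg, Matrix.trace_sub, h1, mul_assoc]
  rw [sub_eq_add_neg]

lemma hasDerivWithinAt_trace_aeval_cosPart {γ : ℝ → Mat n} {γ' : Mat n} {s : Set ℝ} {t : ℝ}
    (h : HasDerivWithinAt γ γ' s t) (p : ℝ[X]) :
    HasDerivWithinAt (fun x => (aeval (cosPart (γ x)) p).trace.re)
      ((aeval (cosPart (γ t)) (derivative p) * cosPart γ').trace.re) s t :=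
  Complex.reCLM.hasFDerivAt.comp_hasDerivWithinAt t
    (hasDerivWithinAt_trace_aeval ((h.add h.star).const_smul (1 / 2 : ℝ)) p)

lemma trace_aeval_deriv_le {γ : ℝ → Mat n} {γ' : Mat n} {s : Set ℝ} {t : ℝ}
    (hs : UniqueDiffWithinAt ℝ s t) (ht : t ∈ s) (hγ : MapsTo γ s (unitaries n))
    (h : HasDerivWithinAt γ γ' s t) {q : ℝ[X]}
    {c : ℝ} (hc : 0 ≤ c) (hq : ∀ x ∈ Icc (-1 : ℝ) 1, q.eval x ^ 2 * (1 - x ^ 2) ≤ c ^ 2) :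
    (aeval (cosPart (γ t)) q * cosPart γ').trace.re ≤ c * unitaryFinsler (γ t) γ' := by
  have hU := hγ ht
  have hA := conjTranspose_mul_deriv_skew hs ht hγ h
  have h1 : γ' = γ t * ((γ t)ᴴ * γ') := by
    rw [← mul_assoc, ← Matrix.star_eq_conjTranspose, Matrix.mem_unitaryGroup_iff.1 hU, one_mul]
  conv_lhs => rw [h1]
  rw [trace_mul_cosPart_deriv hA (commute_aeval (commute_cosPart_star hU) q)]
  refine (Complex.re_le_norm _).trans ((norm_trace_mul_le_of_skew _ hA).trans ?_)
  exact mul_le_mul_of_nonneg_right (norm_aeval_mul_sinPart_le hU hc hq) (traceNorm_nonneg _)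

/-- On an interval where the curve is smooth, a spectral trace function grows at most by the
length of the curve. -/
lemma trace_aeval_sub_le_integral {γ : ℝ → Mat n} {a b : ℝ} (hab : a < b)
    (hγ : MapsTo γ (Icc a b) (unitaries n)) (hs : ContDiffOn ℝ ∞ γ (Icc a b)) {p : ℝ[X]}
    {c : ℝ} (hc : 0 ≤ c)
    (hp : ∀ x ∈ Icc (-1 : ℝ) 1, (derivative p).eval x ^ 2 * (1 - x ^ 2) ≤ c ^ 2) :
    (aeval (cosPart (γ b)) p).trace.re - (aeval (cosPart (γ a)) p).trace.re
      ≤ ∫ t in a..b, c * unitaryFinsler (γ t) (derivWithin γ (Icc a b) t) := by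
  have hd (t : ℝ) (ht : t ∈ Icc a b) :
      HasDerivWithinAt γ (derivWithin γ (Icc a b) t) (Icc a b) t :=
    ((hs.differentiableOn (by simp)) t ht).hasDerivWithinAt
  refine intervalIntegral.sub_le_integral_of_hasDeriv_right_of_le hab.le
    (g := fun t => (aeval (cosPart (γ t)) p).trace.re)
    (fun t ht => (hasDerivWithinAt_trace_aeval_cosPart (hd t ht) p).continuousWithinAt)
    (fun t ht => ((hasDerivWithinAt_trace_aeval_cosPart (hd t (Ioo_subset_Icc_self ht)) p).hasDerivAt
      (Icc_mem_nhds ht.1 ht.2)).hasDerivWithinAt)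
    ((continuousOn_const.mul (continuousOn_unitaryFinsler_derivWithin hab hs)).integrableOn_Icc)
    fun t ht => ?_
  have ht' := Ioo_subset_Icc_self ht
  exact trace_aeval_deriv_le (uniqueDiffOn_Icc hab t ht') ht' hγ (hd t ht') hc hp

lemma trace_aeval_sub_le_curveLength {γ : ℝ → Mat n}
    (hγ : IsPiecewiseSmoothCurve (unitaries n) γ) {p : ℝ[X]} {c : ℝ} (hc : 0 ≤ c)
    (hp : ∀ x ∈ Icc (-1 : ℝ) 1, (derivative p).eval x ^ 2 * (1 - x ^ 2) ≤ c ^ 2) :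
    (aeval (cosPart (γ 1)) p).trace.re - (aeval (cosPart (γ 0)) p).trace.re
      ≤ c * curveLength unitaryFinsler γ := by
  obtain ⟨hmaps, -, k, t, ht, ht0, htk, hsm⟩ := hγ
  have hsub {i : ℕ} (hi : i < k) : Icc (t i) (t (i + 1)) ⊆ Icc 0 1 := by
    refine Icc_subset_Icc ?_ ?_
    · rw [← ht0]; exact ht.monotone (Nat.zero_le i)
    · rw [← htk]; exact ht.monotone hi
  have hlt (i : ℕ) : t i < t (i + 1) := ht (Nat.lt_succ_self i)
  -- The derivatives within a piece and within `[0,1]` may differ at break points, so they are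
  -- compared on open intervals only.
  have heq {i : ℕ} (hi : i < k) : EqOn
      (fun x => c * unitaryFinsler (γ x) (derivWithin γ (Icc (t i) (t (i + 1))) x))
      (fun x => c * unitaryFinsler (γ x) (derivWithin γ (Icc 0 1) x))
      (Ioo (t i) (t (i + 1))) := fun x hx => by
    have h1 : derivWithin γ (Icc (t i) (t (i + 1))) x = deriv γ x :=
      derivWithin_of_mem_nhds (Icc_mem_nhds hx.1 hx.2)
    have h2 : derivWithin γ (Icc 0 1) x = deriv γ x :=
      derivWithin_of_mem_nhds (Filter.mem_of_superset (Icc_mem_nhds hx.1 hx.2) (hsub hi))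
    simp only [h1, h2]
  have hint {i : ℕ} (hi : i < k) : IntervalIntegrable
      (fun x => c * unitaryFinsler (γ x) (derivWithin γ (Icc 0 1) x)) volume (t i) (t (i + 1)) := by
    refine IntervalIntegrable.congr_uIoo (ContinuousOn.intervalIntegrable_of_Icc (hlt i).le
      ((continuousOn_const (c := c)).mul
        (continuousOn_unitaryFinsler_derivWithin (hlt i) (hsm i hi)))) ?_
    rw [uIoo_of_le (hlt i).le]
    exact heq hi
  have hstep {i : ℕ} (hi : i < k) :
      (aeval (cosPart (γ (t (i + 1)))) p).trace.re - (aeval (cosPart (γ (t i))) p).trace.re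
      ≤ ∫ x in t i..t (i + 1), c * unitaryFinsler (γ x) (derivWithin γ (Icc 0 1) x) := by
    refine (trace_aeval_sub_le_integral (hlt i) (hmaps.mono_left (hsub hi)) (hsm i hi) hc hp).trans
      (le_of_eq ?_)
    refine intervalIntegral.integral_congr_uIoo ?_
    rw [uIoo_of_le (hlt i).le]
    exact heq hi
  have hsum := Finset.sum_le_sum fun i hi => hstep (Finset.mem_range.1 hi)
  rw [intervalIntegral.sum_integral_adjacent_intervals (a := t) fun i hi => hint hi,
    Finset.sum_range_sub (fun i => (aeval (cosPart (γ (t i))) p).trace.re), ht0, htk,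
    intervalIntegral.integral_const_mul] at hsum
  exact hsum

/-! ### Minimality -/

lemma cosPart_exp_I_smul {H : Mat n} (hH : H.IsHermitian) :
    cosPart (NormedSpace.exp (Complex.I • H)) = cfc Real.cos H := by
  have hsa : IsSelfAdjoint H := hH
  have hnorm : IsStarNormal H := hsa.isStarNormal
  have hnorm' : IsStarNormal (Complex.I • H) := inferInstance
  have h1 : NormedSpace.exp (Complex.I • H) = cfc (fun x : ℂ => Complex.exp (Complex.I • x)) H := by
    rw [← CFC.complex_exp_eq_normedSpace_exp hnorm', ← cfc_comp_smul Complex.I Complex.exp H]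
  have hf : ContinuousOn (fun x : ℂ => Complex.exp (Complex.I • x)) (spectrum ℂ H) := by fun_prop
  rw [cosPart, h1, ← cfc_star, ← cfc_add H _ _ hf hf.star, cfc_real_eq_complex Real.cos hsa,
    ← cfc_smul (1 / 2 : ℝ) _ H (by fun_prop)]
  refine cfc_congr fun x hx => ?_
  have hx' : (x.re : ℂ) = x := (hsa.mem_spectrum_eq_re hx).symm
  rw [← hx']
  simp only [Complex.ofReal_re, Complex.ofReal_cos, Complex.cos, smul_eq_mul, RCLike.star_def,
    ← Complex.exp_conj, map_mul, Complex.conj_I, Complex.conj_ofReal, Complex.real_smul]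
  push_cast
  ring_nf

/-- A curve of unitaries from `1` to `e^{iH}`, where `‖H‖ ≤ π`, has length at least `‖H‖₁`. -/
lemma traceNorm_le_curveLength {H : Mat n} (hH : H.IsHermitian) (hπ : ‖H‖ ≤ Real.pi)
    {γ : ℝ → Mat n} (hγ : IsPiecewiseSmoothCurve (unitaries n) γ) (h0 : γ 0 = 1)
    (h1 : γ 1 = NormedSpace.exp (Complex.I • H)) :
    traceNorm H ≤ curveLength unitaryFinsler γ := by
  have key (ε : ℝ) (hε : 0 < ε) :
      traceNorm H - n * ε ≤ (1 + ε) * curveLength unitaryFinsler γ := by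
    obtain ⟨p, hp, hp'⟩ := exists_polynomial_near_arccos hε
    refine le_trans ?_ (trace_aeval_sub_le_curveLength hγ (by positivity) hp)
    have hsa : IsSelfAdjoint H := hH
    have e0 : (aeval (cosPart (1 : Mat n)) p).trace.re = ∑ _j : Fin n, p.eval 1 := by
      have : cosPart (1 : Mat n) = algebraMap ℝ (Mat n) 1 := by
        rw [cosPart, star_one, map_one]
        module
      rw [this, aeval_algebraMap_apply, coe_aeval_eq_eval, Matrix.algebraMap_eq_diagonal,
        Matrix.trace_diagonal]
      simp
    have e1 : (aeval (cosPart (NormedSpace.exp (Complex.I • H))) p).trace.re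
        = ∑ j, p.eval (Real.cos (hH.eigenvalues j)) := by
      rw [cosPart_exp_I_smul hH, ← cfc_polynomial p _ (cfc_predicate Real.cos H),
        ← cfc_comp' (fun x => p.eval x) Real.cos H, trace_cfc hH]
      simp
    have e2 : (n : ℝ) * ε = ∑ _j : Fin n, ε := by simp
    rw [h0, h1, e0, e1, e2, traceNorm_eq_sum_eigenvalues hH, ← Finset.sum_sub_distrib,
      ← Finset.sum_sub_distrib]
    refine Finset.sum_le_sum fun j _ => ?_
    have h := hp' _ (Real.cos_mem_Icc (hH.eigenvalues j))
    -- The bound `‖H‖ ≤ π` enters here: `arccos (cos λ) = |λ|` requires `|λ| ≤ π`.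
    rwa [← Real.cos_abs, Real.arccos_cos (abs_nonneg _)
      ((abs_eigenvalues_le_norm hH j).trans hπ), Real.cos_abs] at h
  have hl : Filter.Tendsto (fun ε : ℝ => traceNorm H - n * ε) (nhdsWithin 0 (Ioi 0))
      (nhds (traceNorm H - n * 0)) :=
    ((by fun_prop : Continuous fun ε : ℝ => traceNorm H - n * ε).tendsto 0).mono_left
      nhdsWithin_le_nhds
  have hr : Filter.Tendsto (fun ε : ℝ => (1 + ε) * curveLength unitaryFinsler γ)
      (nhdsWithin 0 (Ioi 0)) (nhds ((1 + 0) * curveLength unitaryFinsler γ)) :=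
    ((by fun_prop : Continuous fun ε : ℝ => (1 + ε) * curveLength unitaryFinsler γ).tendsto
      0).mono_left nhdsWithin_le_nhds
  have := le_of_tendsto_of_tendsto hl hr (Filter.eventually_of_mem self_mem_nhdsWithin key)
  simpa using this

lemma IsSmoothCurve.isPiecewiseSmoothCurve {M : Set (Mat n)} {γ : ℝ → Mat n}
    (h : IsSmoothCurve M γ) : IsPiecewiseSmoothCurve M γ :=
  ⟨h.1, h.2.continuousOn, 1, fun i => i, Nat.strictMono_cast, by simp, by simp, fun i hi => by
    obtain rfl : i = 0 := by omega
    simpa using h.2⟩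

lemma isSmoothCurve_smul {H : Mat n} (hH : H.IsHermitian) :
    IsSmoothCurve (hermitians n) fun t : ℝ => t • H :=
  ⟨fun t _ => isHermitian_real_smul hH t, (contDiff_id.smul contDiff_const).contDiffOn⟩

lemma curveLength_smul (H : Mat n) :
    curveLength hermitianFinsler (fun t : ℝ => t • H) = traceNorm H := by
  have h : EqOn (fun t : ℝ => hermitianFinsler (t • H) (derivWithin (fun t : ℝ => t • H) (Icc 0 1) t))
      (fun _ => traceNorm H) (uIcc 0 1) := fun t ht => by
    rw [uIcc_of_le zero_le_one] at ht
    have hd : HasDerivAt (fun t : ℝ => t • H) ((1 : ℝ) • H) t := (hasDerivAt_id t).smul_const H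
    simp only [hermitianFinsler,
      hd.hasDerivWithinAt.derivWithin (uniqueDiffOn_Icc zero_lt_one t ht), one_smul]
  rw [curveLength, intervalIntegral.integral_congr h]
  simp

end TraceNormCurves

theorem mainTheorem5 (n : ℕ) :
    (∀ X : ℝ → Mat n, IsSmoothCurve (hermitians n) X →
      IsSmoothCurve (unitaries n) (expCurve X) ∧
      curveLength unitaryFinsler (expCurve X) ≤ curveLength hermitianFinsler X) ∧
    (∀ Y : ℝ → Mat n, IsSmoothCurve (hermitians n) Y →
      IsMinimalCurve (hermitians n) hermitianFinsler Y →
      Y 0 = 0 → ‖Y 1‖ ≤ Real.pi →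
      IsMinimalCurve (unitaries n) unitaryFinsler (expCurve Y)) := by
  refine ⟨fun X hX => ⟨isSmoothCurve_expCurve hX, curveLength_expCurve_le hX⟩,
    fun Y hY hmin hY0 hY1 => ⟨(isSmoothCurve_expCurve hY).isPiecewiseSmoothCurve,
      fun δ hδ h0 h1 => ?_⟩⟩
  have hH : (Y 1).IsHermitian := hY.1 (by simp)
  calc curveLength unitaryFinsler (expCurve Y) ≤ curveLength hermitianFinsler Y :=
        curveLength_expCurve_le hY
    -- Minimality of `Y` is needed only against the straight segment from `0` to `Y 1`.
    _ ≤ curveLength hermitianFinsler (fun t : ℝ => t • Y 1) :=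
        hmin.2 _ (isSmoothCurve_smul hH).isPiecewiseSmoothCurve (by simp [hY0]) (by simp)
    _ = traceNorm (Y 1) := curveLength_smul _
    _ ≤ curveLength unitaryFinsler δ :=
        traceNorm_le_curveLength hH hY1 hδ (by simp [h0, expCurve, hY0]) h1
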